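/- Let $\rho_1 \colon \mathbb{R} \to \mathbb{R}$ be continuous, non-affine, and continuously differentiable at at least one point (i.e. differentiable in a neighbourhood of that point, with derivative continuous at the point), with non-zero derivative at that point. Let $\rho_2(x) = \max(x,0)$ be the ReLU function and let $n_0 \in \mathbb{N}$. Let $\mathcal{NN}^{\rho_1,\rho_2}_{n_0;1}$ be the set of deep feed-forward neural networks $\varphi \colon \mathbb{R}^{n_0} \to \mathbb{R}$ with activation functions $\rho_1$ and $\rho_2$, i.e. all functions of the form $$\varphi = w_L \circ \sigma_{L-1} \circ w_{L-1} \circ \cdots \circ \sigma_1 \circ w_1,$$ where $L \geq 1$, $N_0 = n_0$, $N_1, \ldots, N_{L-1} \geq 1$ and $N_L = 1$ are integers, each $w_l \colon \mathbb{R}^{N_{l-1}} \to \mathbb{R}^{N_l}$, $w_l(x) = A_l x + b_l$, is an affine map, and each $\sigma_l \in \{\rho_1, \rho_2\}$ is applied componentwise. Let $\psi(x) = 1 + |x|$ for $x \in \mathbb{R}^{n_0}$, with the Euclidean norm $|\cdot|$, let $$\|f\|_{\mathcal{B}_\psi(\mathbb{R}^{n_0};\mathbb{R})} := \sup_{x \in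 \mathbb{R}^{n_0}} \frac{|f(x)|}{\psi(x)}$$ for those $f \colon \mathbb{R}^{n_0} \to \mathbb{R}$ for which this supremum is finite, and let $\mathcal{B}_\psi(\mathbb{R}^{n_0};\mathbb{R})$ be the closure of the bounded continuous functions $\mathbb{R}^{n_0} \to \mathbb{R}$ with respect to this norm (within the space of functions with finite norm). Then $\mathcal{NN}^{\rho_1,\rho_2}_{n_0;1}$ is dense in $\mathcal{B}_\psi(\mathbb{R}^{n_0};\mathbb{R})$ in the following sense: for every $f \in \mathcal{B}_\psi(\mathbb{R}^{n_0};\mathbb{R})$ and every $\epsilon > 0$ there exists $\varphi \in \mathcal{NN}^{\rho_1,\rho_2}_{n_0;1}$ such that $$\|f - \varphi\|_{\mathcal{B}_\psi(\mathbb{R}^{n_0};\mathbb{R})} = \sup_{x \in \mathbb{R}^{n_0}} \frac{|f(x) - \varphi(x)|}{\psi(x)} < \epsilon .$$ -/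

import Mathlib

open Filter Topology
open scoped BoundedContinuousFunction

noncomputable section

/-- The rectified linear unit. -/
def relu (x : ℝ) : ℝ := max x 0

/-- `ρ` is an affine function on the real line. -/
def IsAffineFun (ρ : ℝ → ℝ) : Prop := ∃ a b : ℝ, ∀ x, ρ x = a * x + b

/-- `ρ` is continuously differentiable at `x`: it is differentiable in a neighbourhood of `x` and
its derivative is continuous at `x`. -/
def IsContinuouslyDifferentiableAt (ρ : ℝ → ℝ) (x : ℝ) : Prop :=
  (∀ᶠ y in 𝓝 x, DifferentiableAt ℝ ρ y) ∧ ContinuousAt (deriv ρ) x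

/-- The affine map `x ↦ A x + b`. -/
def affineLayer {p q : ℕ} (A : Matrix (Fin q) (Fin p) ℝ) (b : EuclideanSpace ℝ (Fin q))
    (x : EuclideanSpace ℝ (Fin p)) : EuclideanSpace ℝ (Fin q) :=
  Matrix.toEuclideanLin A x + b

/-- The function `ρ` applied to every coordinate of a vector. -/
def applyComponentwise {q : ℕ} (ρ : ℝ → ℝ) (x : EuclideanSpace ℝ (Fin q)) :
    EuclideanSpace ℝ (Fin q) :=
  WithLp.toLp 2 fun i => ρ (x i)

/-- `IsDeepNetwork ρ₁ ρ₂ Φ` says that `Φ : ℝᵖ → ℝᵐ` is a deep feed-forward neural network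
`Φ = w_L ∘ σ_{L-1} ∘ w_{L-1} ∘ ⋯ ∘ σ₁ ∘ w₁` of some depth `L ≥ 1`, with affine maps `w_l`,
hidden layers of arbitrary positive widths, and, in every hidden layer, an activation function
`σ_l ∈ {ρ₁, ρ₂}` applied componentwise. -/
inductive IsDeepNetwork (ρ₁ ρ₂ : ℝ → ℝ) {m : ℕ} : {p : ℕ} →
    (EuclideanSpace ℝ (Fin p) → EuclideanSpace ℝ (Fin m)) → Prop
  /-- Depth one: no hidden layer. -/
  | affine {p : ℕ} (A : Matrix (Fin m) (Fin p) ℝ) (b : EuclideanSpace ℝ (Fin m)) :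
      IsDeepNetwork ρ₁ ρ₂ (affineLayer A b)
  /-- One more hidden layer, of width `q`, placed next to the input. -/
  | layer {p q : ℕ} (hq : 0 < q) (A : Matrix (Fin q) (Fin p) ℝ) (b : EuclideanSpace ℝ (Fin q))
      (σ : ℝ → ℝ) (hσ : σ = ρ₁ ∨ σ = ρ₂)
      (Φ : EuclideanSpace ℝ (Fin q) → EuclideanSpace ℝ (Fin m)) (hΦ : IsDeepNetwork ρ₁ ρ₂ Φ) :
      IsDeepNetwork ρ₁ ρ₂ (Φ ∘ applyComponentwise σ ∘ affineLayer A b)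

/-- The real-valued deep networks on `ℝⁿ` with activation functions `ρ₁` and `ρ₂`, that is,
those with output dimension one, where `ℝ¹` is identified with `ℝ`. -/
def deepNetworks (ρ₁ ρ₂ : ℝ → ℝ) (n : ℕ) : Set (EuclideanSpace ℝ (Fin n) → ℝ) :=
  {φ | ∃ Φ : EuclideanSpace ℝ (Fin n) → EuclideanSpace ℝ (Fin 1),
    IsDeepNetwork ρ₁ ρ₂ Φ ∧ ∀ x, φ x = Φ x 0}

/-- The weight `ψ(x) = 1 + |x|`, with the Euclidean norm. -/
def weight {n : ℕ} (x : EuclideanSpace ℝ (Fin n)) : ℝ := 1 + ‖x‖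

/-- `sup_x |f(x)| / ψ(x) < ∞`. -/
def HasFiniteWeightedNorm {n : ℕ} (f : EuclideanSpace ℝ (Fin n) → ℝ) : Prop :=
  BddAbove (Set.range fun x => |f x| / weight x)

/-- The weighted norm `sup_x |f(x)| / ψ(x)`, meaningful if `HasFiniteWeightedNorm f`. -/
def weightedNorm {n : ℕ} (f : EuclideanSpace ℝ (Fin n) → ℝ) : ℝ :=
  ⨆ x, |f x| / weight x

/-- The weighted space `B_ψ(ℝⁿ; ℝ)`: the closure of the bounded continuous functions with
respect to the weighted norm, among the functions for which this norm is finite. -/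
def weightedSpace (n : ℕ) : Set (EuclideanSpace ℝ (Fin n) → ℝ) :=
  {f | HasFiniteWeightedNorm f ∧
    ∀ δ > 0, ∃ g : EuclideanSpace ℝ (Fin n) →ᵇ ℝ,
      HasFiniteWeightedNorm (fun x => f x - g x) ∧ weightedNorm (fun x => f x - g x) < δ}

end

/-! ReLU layers alone suffice. By definition of the weighted space it is enough to approximate a
bounded continuous `g`. Since max(a, b) = a + relu(b - a), ReLU functions form a lattice, and they
take prescribed values at two points, so the lattice form of Stone–Weierstrass gives uniform
approximation on a large closed ball. Clipping the approximant to [-‖g‖, ‖g‖] keeps it a ReLU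
function; outside the ball the error is at most 2‖g‖, which the growing weight absorbs.
`IsDeepNetwork.comp_reluSpan` turns these functions into actual networks. -/

/-- The functions computed by linear combinations of the outputs of `d` layers of ReLU units; the
layer of depth zero consists of the affine functions. -/
def reluSpan (p : ℕ) : ℕ → Submodule ℝ (EuclideanSpace ℝ (Fin p) → ℝ)
  | 0 => Submodule.span ℝ (Set.range fun i : Option (Fin p) => fun x => i.elim 1 fun j => x j)
  | d + 1 => Submodule.span ℝ ((fun (h : EuclideanSpace ℝ (Fin p) → ℝ) x => relu (h x)) ''
      (reluSpan p d : Set (EuclideanSpace ℝ (Fin p) → ℝ)))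

theorem relu_comp_mem_reluSpan {p d : ℕ} {h : EuclideanSpace ℝ (Fin p) → ℝ}
    (hh : h ∈ reluSpan p d) : (fun x => relu (h x)) ∈ reluSpan p (d + 1) :=
  Submodule.subset_span ⟨h, hh, rfl⟩

theorem relu_sub_relu_neg (t : ℝ) : relu t - relu (-t) = t := by
  unfold relu
  rcases le_total t 0 with h | h
  · rw [max_eq_right h, max_eq_left (by linarith)]; ring
  · rw [max_eq_left h, max_eq_right (by linarith)]; ring

/-- A pair of ReLU units carries a value unchanged through one more layer, so functions of different
depths can be brought to a common depth. -/
theorem reluSpan_mono (p : ℕ) : Monotone (reluSpan p) := by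
  refine monotone_nat_of_le_succ fun d h hh => ?_
  have := Submodule.sub_mem _ (relu_comp_mem_reluSpan hh)
    (relu_comp_mem_reluSpan (Submodule.neg_mem _ hh))
  convert this using 1
  funext x
  exact (relu_sub_relu_neg (h x)).symm

theorem const_mem_reluSpan_zero (p : ℕ) (c : ℝ) : (fun _ => c) ∈ reluSpan p 0 := by
  have : (fun _ => 1) ∈ reluSpan p 0 := Submodule.subset_span ⟨none, rfl⟩
  convert Submodule.smul_mem _ c this using 1
  funext x
  simp

theorem coord_mem_reluSpan_zero {p : ℕ} (i : Fin p) : (fun x => x i) ∈ reluSpan p 0 :=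
  Submodule.subset_span ⟨some i, rfl⟩

/-- The functions computed by ReLU layers, of any depth. -/
def IsReluFun {p : ℕ} (f : EuclideanSpace ℝ (Fin p) → ℝ) : Prop := ∃ d, f ∈ reluSpan p d

namespace IsReluFun

variable {p : ℕ} {f g : EuclideanSpace ℝ (Fin p) → ℝ}

theorem const (c : ℝ) : IsReluFun (fun _ : EuclideanSpace ℝ (Fin p) => c) :=
  ⟨0, const_mem_reluSpan_zero p c⟩

theorem sup (hf : IsReluFun f) (hg : IsReluFun g) : IsReluFun fun x => max (f x) (g x) := by
  obtain ⟨d, hd⟩ := hf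
  obtain ⟨e, he⟩ := hg
  have hf' := reluSpan_mono p (le_max_left d e) hd
  have hg' := reluSpan_mono p (le_max_right d e) he
  refine ⟨max d e + 1, ?_⟩
  -- max(f, g) = f + relu(g - f).
  convert Submodule.add_mem _ (reluSpan_mono p (Nat.le_succ _) hf')
    (relu_comp_mem_reluSpan (Submodule.sub_mem _ hg' hf')) using 1
  funext x
  simp only [relu, Pi.add_apply, Pi.sub_apply]
  rw [← max_add_add_left, max_comm]
  simp

theorem neg (hf : IsReluFun f) : IsReluFun fun x => -f x :=
  hf.imp fun _ => Submodule.neg_mem _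

theorem inf (hf : IsReluFun f) (hg : IsReluFun g) : IsReluFun fun x => min (f x) (g x) := by
  convert (hf.neg.sup hg.neg).neg using 2
  rw [max_neg_neg, neg_neg]

end IsReluFun

theorem affineLayer_comp {p q m : ℕ} (A : Matrix (Fin m) (Fin q) ℝ) (b : EuclideanSpace ℝ (Fin m))
    (A' : Matrix (Fin q) (Fin p) ℝ) (b' : EuclideanSpace ℝ (Fin q)) :
    affineLayer A b ∘ affineLayer A' b' = affineLayer (A * A') (affineLayer A b b') := by
  funext x
  ext i
  simp [affineLayer, add_assoc]

theorem IsDeepNetwork.comp_affineLayer {ρ₁ ρ₂ : ℝ → ℝ} {p q m : ℕ}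
    {Φ : EuclideanSpace ℝ (Fin q) → EuclideanSpace ℝ (Fin m)} (hΦ : IsDeepNetwork ρ₁ ρ₂ Φ)
    (A : Matrix (Fin q) (Fin p) ℝ) (b : EuclideanSpace ℝ (Fin q)) :
    IsDeepNetwork ρ₁ ρ₂ (Φ ∘ affineLayer A b) := by
  cases hΦ with
  | affine A' b' => rw [affineLayer_comp]; exact .affine _ _
  | layer hq A' b' σ hσ Φ hΦ =>
    rw [Function.comp_assoc, Function.comp_assoc, affineLayer_comp]
    exact .layer hq _ _ σ hσ Φ hΦ

/-- A network whose inputs are functions computed by `d` layers of ReLU units is a network. -/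
theorem IsDeepNetwork.comp_reluSpan {ρ₁ : ℝ → ℝ} {p m : ℕ} (d : ℕ) :
    ∀ {q : ℕ} (g : Fin q → EuclideanSpace ℝ (Fin p) → ℝ), (∀ i, g i ∈ reluSpan p d) →
    ∀ Φ : EuclideanSpace ℝ (Fin q) → EuclideanSpace ℝ (Fin m), IsDeepNetwork ρ₁ relu Φ →
      IsDeepNetwork ρ₁ relu fun x => Φ (WithLp.toLp 2 fun i => g i x) := by
  induction d with
  | zero =>
    intro q g hg Φ hΦ
    have h : ∀ i, ∃ c : Option (Fin p) → ℝ, ∑ j, c j • (fun x : EuclideanSpace ℝ (Fin p) =>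
        (j.elim 1 fun k => x k : ℝ)) = g i :=
      fun i => (Submodule.mem_span_range_iff_exists_fun ℝ).1 (hg i)
    choose c hc using h
    convert hΦ.comp_affineLayer (Matrix.of fun i j => c i (some j))
      (WithLp.toLp 2 fun i => c i none) using 1
    funext x
    refine congrArg Φ ?_
    ext i
    simp [affineLayer, ← hc, Matrix.mulVec, dotProduct, add_comm]
  | succ d ih =>
    intro q g hg Φ hΦ
    have h : ∀ i, ∃ (n : ℕ) (a : Fin n → ℝ) (h : Fin n → EuclideanSpace ℝ (Fin p) → ℝ),
        (∀ j, h j ∈ reluSpan p d) ∧ ∀ x, g i x = ∑ j, a j * relu (h j x) := by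
      intro i
      obtain ⟨n, a, u, hu⟩ := Submodule.mem_span_set'.1 (hg i)
      choose h hh hu' using fun j => (u j).2
      refine ⟨n, a, h, hh, fun x => ?_⟩
      simp [← hu, ← hu']
    choose n a h hh hg using h
    -- the extra unit keeps the hidden layer nonempty
    let e := Fintype.equivFin (Option (Σ i, Fin (n i)))
    let H : Option (Σ i, Fin (n i)) → EuclideanSpace ℝ (Fin p) → ℝ :=
      fun s => s.elim 0 fun t => h t.1 t.2
    let B : Fin q → Option (Σ i, Fin (n i)) → ℝ :=
      fun i s => s.elim 0 fun t => if t.1 = i then a t.1 t.2 else 0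
    have hH : ∀ s, H s ∈ reluSpan p d := by
      rintro (_ | t)
      · exact Submodule.zero_mem _
      · exact hh _ _
    -- One hidden layer holds the units of all `q` outputs side by side. The identity matrix feeds
    -- `H` into it, and the block matrix `B` recombines its outputs, merging with the first affine
    -- map of `Φ`.
    have key := ih (fun k => H (e.symm k)) (fun k => hH _) _
      (.layer (Fintype.card_pos) 1 0 relu (.inr rfl) _
        (hΦ.comp_affineLayer (Matrix.of fun i k => B i (e.symm k)) 0))
    convert key using 1
    funext x
    refine congrArg Φ ?_
    ext i
    simp only [affineLayer, applyComponentwise, Function.comp_apply, add_zero,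
      Matrix.toLpLin_apply, Matrix.one_mulVec, Matrix.mulVec, dotProduct, Matrix.of_apply]
    rw [e.symm.sum_comp (fun s => B i s * relu (H s x)), Fintype.sum_option, Fintype.sum_sigma, hg]
    simp [B, H, ite_mul, Finset.sum_ite_irrel]

theorem IsReluFun.mem_deepNetworks {ρ₁ : ℝ → ℝ} {p : ℕ} {f : EuclideanSpace ℝ (Fin p) → ℝ}
    (hf : IsReluFun f) : f ∈ deepNetworks ρ₁ relu p := by
  obtain ⟨d, hd⟩ := hf
  refine ⟨_, IsDeepNetwork.comp_reluSpan (m := 1) d (fun _ : Fin 1 => f) (fun _ => hd) _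
    (.affine 1 0), fun x => ?_⟩
  simp [affineLayer]

/-- The two-point condition of Stone–Weierstrass, met by an affine function of a coordinate in which
the points differ. -/
theorem exists_isReluFun_interpolating {p : ℕ} {x y : EuclideanSpace ℝ (Fin p)} (hxy : x ≠ y)
    (s t : ℝ) : ∃ f, IsReluFun f ∧ Continuous f ∧ f x = s ∧ f y = t := by
  obtain ⟨i, hi⟩ : ∃ i, x i ≠ y i := by
    by_contra! h
    exact hxy (by ext i; exact h i)
  have hi' : x i - y i ≠ 0 := sub_ne_zero.2 hi
  refine ⟨_, ⟨0, Submodule.add_mem _ (Submodule.smul_mem _ ((s - t) / (x i - y i))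
    (coord_mem_reluSpan_zero i)) (const_mem_reluSpan_zero p (s - (s - t) / (x i - y i) * x i))⟩,
    ?_, ?_, ?_⟩
  · exact ((by fun_prop : Continuous fun z : EuclideanSpace ℝ (Fin p) => z i).const_smul _).add
      continuous_const
  · simp
  · simp only [Pi.add_apply, Pi.smul_apply, smul_eq_mul]
    field_simp
    ring

/-- ReLU functions are uniformly dense in the continuous functions on a compact set. -/
theorem exists_isReluFun_abs_sub_lt {p : ℕ} {K : Set (EuclideanSpace ℝ (Fin p))}
    (hK : IsCompact K) {g : EuclideanSpace ℝ (Fin p) → ℝ} (hg : Continuous g) {δ : ℝ}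
    (hδ : 0 < δ) : ∃ f, IsReluFun f ∧ ∀ x ∈ K, |g x - f x| < δ := by
  have : CompactSpace K := isCompact_iff_compactSpace.1 hK
  let S : Set C(K, ℝ) := {u | ∃ f : EuclideanSpace ℝ (Fin p) → ℝ, IsReluFun f ∧ ∀ x : K, u x = f x}
  have hS : closure S = ⊤ := by
    refine ContinuousMap.sublattice_closure_eq_top S ⟨0, _, .const 0, fun _ => rfl⟩ ?_ ?_ ?_
    · rintro u ⟨f, hf, hu⟩ v ⟨f', hf', hv⟩
      exact ⟨_, hf.inf hf', fun x => by simp [hu, hv]⟩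
    · rintro u ⟨f, hf, hu⟩ v ⟨f', hf', hv⟩
      exact ⟨_, hf.sup hf', fun x => by simp [hu, hv]⟩
    · intro v x y
      rcases eq_or_ne x y with rfl | hxy
      · exact ⟨.const K (v x), ⟨_, .const (v x), fun _ => rfl⟩, rfl, rfl⟩
      · obtain ⟨f, hf, hfc, hfx, hfy⟩ :=
          exists_isReluFun_interpolating (Subtype.coe_ne_coe.2 hxy) (v x) (v y)
        exact ⟨⟨fun z => f z, by fun_prop⟩, ⟨f, hf, fun _ => rfl⟩, hfx, hfy⟩
  have hmem : (⟨fun x : K => g x, by fun_prop⟩ : C(K, ℝ)) ∈ closure S := by rw [hS]; trivial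
  obtain ⟨u, ⟨f, hf, hu⟩, hdist⟩ := Metric.mem_closure_iff.1 hmem δ hδ
  refine ⟨f, hf, fun x hx => ?_⟩
  have := (ContinuousMap.dist_lt_iff hδ).1 hdist ⟨x, hx⟩
  rwa [hu, Real.dist_eq] at this

theorem weight_pos {n : ℕ} (x : EuclideanSpace ℝ (Fin n)) : 0 < weight x := by
  unfold weight; positivity

theorem exists_isReluFun_abs_sub_le_mul_weight {n : ℕ} (g : EuclideanSpace ℝ (Fin n) →ᵇ ℝ) {δ : ℝ}
    (hδ : 0 < δ) : ∃ f, IsReluFun f ∧ ∀ x, |g x - f x| ≤ δ * weight x := by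
  have hM : ∀ x, |g x| ≤ ‖g‖ := g.norm_coe_le_norm
  -- The radius is chosen so that 2‖g‖ < δ‖x‖ outside the ball.
  obtain ⟨f, hf, hfg⟩ := exists_isReluFun_abs_sub_lt
    (isCompact_closedBall (0 : EuclideanSpace ℝ (Fin n)) (2 * ‖g‖ / δ)) g.continuous hδ
  refine ⟨_, (hf.sup (.const (-‖g‖))).inf (.const ‖g‖), fun x => ?_⟩
  obtain ⟨h1, h2⟩ := abs_le.1 (hM x)
  have hx := norm_nonneg x
  rcases le_or_gt ‖x‖ (2 * ‖g‖ / δ) with h | h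
  · have h3 := (hfg x (by simpa using h)).le
    -- Clipping fixes `g x` and is 1-Lipschitz, so it does not increase the error.
    calc |g x - min (max (f x) (-‖g‖)) ‖g‖|
        = |min (max (g x) (-‖g‖)) ‖g‖ - min (max (f x) (-‖g‖)) ‖g‖| := by
          rw [max_eq_left h1, min_eq_left h2]
      _ ≤ |max (g x) (-‖g‖) - max (f x) (-‖g‖)| := abs_inf_sub_inf_le_abs _ _ _
      _ ≤ |g x - f x| := abs_sup_sub_sup_le_abs _ _ _
      _ ≤ δ * weight x := by unfold weight; nlinarith
  · have h4 : -‖g‖ ≤ min (max (f x) (-‖g‖)) ‖g‖ :=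
      le_min (le_max_right _ _) (by linarith [norm_nonneg g])
    have h5 : min (max (f x) (-‖g‖)) ‖g‖ ≤ ‖g‖ := min_le_right _ _
    rw [div_lt_iff₀ hδ] at h
    rw [abs_le]
    unfold weight
    constructor <;> nlinarith

theorem mainTheorem5 (ρ₁ : ℝ → ℝ) (hcont : Continuous ρ₁) (hna : ¬ IsAffineFun ρ₁)
    (hdiff : ∃ x₀ : ℝ, IsContinuouslyDifferentiableAt ρ₁ x₀ ∧ deriv ρ₁ x₀ ≠ 0)
    (n₀ : ℕ) (f : EuclideanSpace ℝ (Fin n₀) → ℝ) (hf : f ∈ weightedSpace n₀)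
    (ε : ℝ) (hε : 0 < ε) :
    ∃ φ ∈ deepNetworks ρ₁ relu n₀,
      HasFiniteWeightedNorm (fun x => f x - φ x) ∧ weightedNorm (fun x => f x - φ x) < ε := by
  obtain ⟨-, hf⟩ := hf
  obtain ⟨g, hbdd, hfg⟩ := hf (ε / 3) (by positivity)
  obtain ⟨φ, hφ, hgφ⟩ := exists_isReluFun_abs_sub_le_mul_weight g (show 0 < ε / 3 by positivity)
  -- The supremum only inherits a non-strict bound; the spare third of `ε` makes it strict.
  have hle : ∀ x, |f x - φ x| / weight x ≤ ε / 3 + ε / 3 := fun x => by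
    have h1 : |f x - g x| / weight x ≤ ε / 3 := (le_ciSup hbdd x).trans hfg.le
    rw [div_le_iff₀ (weight_pos x)] at h1 ⊢
    rw [add_mul]
    exact (abs_sub_le _ (g x) _).trans (add_le_add h1 (hgφ x))
  exact ⟨φ, hφ.mem_deepNetworks, ⟨_, Set.forall_mem_range.2 hle⟩,
    (ciSup_le hle).trans_lt (by linarith)⟩
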